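/- Let $\lambda>-1/2$. For $z>0$ let $(P_n(x;z))_{n\ge 0}$ be the sequence of monic polynomials orthogonal with respect to the generalized Gauss--Rys functional $$\langle \mathbf s_z,p\rangle=\int_{-1}^1 p(x)\,(1-x^2)^{\lambda-1/2}e^{-zx^2}\,dx ,$$ let $h_n(z)=\langle \mathbf s_z,P_n^2\rangle$, and let $\gamma_0=0$, $\gamma_n(z)=h_n(z)/h_{n-1}(z)$ for $n\ge1$. These are the coefficients of the three-term recurrence $xP_n=P_{n+1}+\gamma_nP_{n-1}$, $P_{-1}=0$, $P_0=1$. Set $$\beta_n^2(z)=\frac{n+\lambda}{z}+1-\bigl(\gamma_n(z)+\gamma_{n+1}(z)\bigr).$$ For $n\ge1$ and $z>0$, $P_n(\cdot\,;z)$ has exactly $n$ distinct real zeros, all in $(-1,1)$; write them in increasing order as $x_{n,1}(z)<\dots<x_{n,n}(z)$. Then: 1. For all $n\ge2$, $z>0$ and $x\in\mathbb R$, $\;\partial_zP_n(x;z)=\gamma_n(z)\gamma_{n-1}(z)P_{n-2}(x;z)$. 2. For all $n\ge1$, $1\le k\le n$ and $z>0$, one has $\beta_n^2(z)-x_{n,k}(z)^2>0$,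 the function $x_{n,k}$ is differentiable at $z$, and $$\frac{dx_{n,k}}{dz}=-\frac{x_{n,k}}{2z}\,\frac{1-x_{n,k}^2}{\beta_n^2-x_{n,k}^2}.$$ 3. For all $n\ge1$ and $1\le k\le n$, the square $y_{n,k}(z)=x_{n,k}(z)^2$ is a nonincreasing function of $z\in(0,\infty)$. If $2k=n+1$ (the middle zero for odd $n$), then $x_{n,k}(z)=0$ for all $z>0$. If $2k\ne n+1$, then $x_{n,k}(z)\neq0$ for all $z>0$, $y_{n,k}$ is strictly decreasing on $(0,\infty)$, and for every $z>0$ $$\dot y_{n,k}(z)<0,\qquad \dot y_{n,k}\left(\frac{\beta_n^2}{y_{n,k}}+\frac{\beta_n^2-1}{1-y_{n,k}}\right)=-\frac1z .$$ -/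

import Mathlib

open Polynomial

noncomputable section

namespace GaussRys

/-- The generalized Gauss-Rys functional
`p ↦ ∫_{-1}^{1} p(x) (1 - x^2)^(lam - 1/2) exp(-z x^2) dx` on polynomials. -/
def functional (lam z : ℝ) (p : ℝ[X]) : ℝ :=
  ∫ x in (-1 : ℝ)..1, p.eval x * ((1 - x ^ 2) ^ (lam - 1 / 2) * Real.exp (-z * x ^ 2))

/-- `Q` is the sequence of monic orthogonal polynomials with respect to `u`. -/
def IsSMOP (u : ℝ[X] → ℝ) (Q : ℕ → ℝ[X]) : Prop :=
  (∀ n, (Q n).Monic ∧ (Q n).natDegree = n) ∧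
  (∀ m n, m ≠ n → u (Q m * Q n) = 0) ∧
  (∀ n, u (Q n * Q n) ≠ 0)

/-- The monic polynomials obtained from `1, X, X^2, …` by Gram-Schmidt orthogonalization
with respect to `u`. -/
def monicOP (u : ℝ[X] → ℝ) (n : ℕ) : ℝ[X] :=
  X ^ n - ∑ k : Fin n,
    C (u (X ^ n * monicOP u k) / u (monicOP u k * monicOP u k)) * monicOP u k
termination_by n
decreasing_by all_goals exact k.2

/-- The generalized Gauss-Rys polynomial `P_n(x; z; lam)`. -/
def P (lam z : ℝ) (n : ℕ) : ℝ[X] := monicOP (functional lam z) n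

/-- The squared norm `h_n`. -/
def h (lam z : ℝ) (n : ℕ) : ℝ := functional lam z (P lam z n * P lam z n)

/-- The coefficients of `x P_n = P_{n+1} + γ_n P_{n-1}`: `γ_0 = 0` and `γ_n = h_n / h_{n-1}`
for `n ≥ 1`. -/
def γ (lam z : ℝ) : ℕ → ℝ
  | 0 => 0
  | n + 1 => h lam z (n + 1) / h lam z n

/-- The quantity `β_n^2`. -/
def betaSq (lam z : ℝ) (n : ℕ) : ℝ :=
  (n + lam) / z + 1 - (γ lam z n + γ lam z (n + 1))

/-- The real zeros of `P_n(x; z; lam)` in increasing order; the index `k` starts at `0`, so that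
this is `x_{n,k+1}(z; lam)`. The value for an index `k` without a zero is irrelevant. -/
def zero (lam : ℝ) (n k : ℕ) (z : ℝ) : ℝ :=
  ((P lam z n).roots.sort (· ≤ ·)).getD k 0

end GaussRys

end

open Polynomial

noncomputable section

namespace GaussRys

/-! ### Monic orthogonal polynomials for a positive symmetric functional. -/

section Orthogonal

variable {u : ℝ[X] →ₗ[ℝ] ℝ} {Q : ℕ → ℝ[X]}

/-! Everything follows from orthogonality and two facts about the weight: differentiating it in `z`
multiplies it by `-x²`, and it satisfies a Pearson equation in `x` (`functional_pearson`).

Differentiating `⟨P_{n+1}, x^j⟩ = 0` in `z` determines `∂_z P_{n+1}`, a polynomial of degree at most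
`n`, as `γ_{n+1} (x P_n - P_{n+1})` (`hasDerivAt_P_coeff`). The Pearson equation expresses `(1 - x²)
P_{n+1}'` through neighbouring polynomials (`structure_relation`); at a zero `x` of `P_{n+1}` this
reduces to `(1 - x²) P_{n+1}' = 2 z γ_{n+1} (β² - x²) P_n`. Implicit differentiation gives `x' =
-∂_z P_{n+1} / P_{n+1}' = -γ_{n+1} x P_n / P_{n+1}'`, where `P_n` cancels, leaving the stated
equation.

The sign of `β² - x²` comes from the positive Wronskian `P_{n+1}' P_n - P_n' P_{n+1}`
(`wronskian_pos`). Differentiability of the indexed zeros rests on their continuity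
(`continuousAt_zero`), which uses that there are exactly `n` simple real zeros. Parity of `P_n`
identifies the one zero that stays at the origin. -/

theorem degree_sub_C_mul_lt {p q : ℝ[X]} {n : ℕ} (hp : p.degree < (n + 1 : ℕ)) (hq : q.Monic)
    (hn : q.natDegree = n) : (p - C (p.coeff n) * q).degree < n := by
  rw [degree_lt_iff_coeff_zero] at hp ⊢
  intro m hm
  rw [coeff_sub, coeff_C_mul]
  rcases hm.eq_or_lt with rfl | hlt
  · have : q.coeff n = 1 := by rw [← hn]; exact hq
    simp [this]
  · rw [hp m hlt, coeff_eq_zero_of_natDegree_lt (by omega : q.natDegree < m)]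
    simp

/-- Here `Q` need not be orthogonal: any monic family with one member per degree spans. It is
applied both to the orthogonal sequence and to the powers of `X`. -/
theorem map_mul_eq_zero_of_forall {p : ℝ[X]} {n : ℕ}
    (hQ : ∀ n, (Q n).Monic ∧ (Q n).natDegree = n) (h : ∀ j < n, u (p * Q j) = 0)
    {q : ℝ[X]} (hq : q.degree < n) : u (p * q) = 0 := by
  induction n generalizing q with
  | zero =>
    have : q = 0 := by simpa using hq
    simp [this]
  | succ n ih =>
    have h1 := ih (fun j hj => h j (by omega))
      (degree_sub_C_mul_lt hq (hQ n).1 (hQ n).2)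
    have h2 : p * q = p * (q - C (q.coeff n) * Q n) + q.coeff n • (p * Q n) := by
      rw [smul_eq_C_mul]; ring
    rw [h2, map_add, map_smul, h1, h n (by omega)]
    simp

theorem eq_zero_of_forall_map_mul (hpos : ∀ p : ℝ[X], p ≠ 0 → 0 < u (p * p)) {p : ℝ[X]} {n : ℕ}
    (hp : p.degree < n) (h : ∀ q : ℝ[X], q.degree < n → u (p * q) = 0) : p = 0 := by
  by_contra hne
  exact (hpos p hne).ne' (h p hp)

theorem IsSMOP.map_mul_eq_zero (hQ : IsSMOP u Q) {n : ℕ} {q : ℝ[X]} (hq : q.degree < n) :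
    u (Q n * q) = 0 :=
  map_mul_eq_zero_of_forall hQ.1 (fun j hj => hQ.2.1 n j hj.ne') hq

theorem IsSMOP.map_mul_eq (hQ : IsSMOP u Q) {n : ℕ} {q : ℝ[X]} (hq : q.degree < (n + 1 : ℕ)) :
    u (Q n * q) = q.coeff n * u (Q n * Q n) := by
  have h1 := hQ.map_mul_eq_zero (degree_sub_C_mul_lt hq (hQ.1 n).1 (hQ.1 n).2)
  have h2 : Q n * q = Q n * (q - C (q.coeff n) * Q n) + q.coeff n • (Q n * Q n) := by
    rw [smul_eq_C_mul]; ring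
  rw [h2, map_add, map_smul, h1]
  simp

theorem IsSMOP.degree_eq (hQ : IsSMOP u Q) (n : ℕ) : (Q n).degree = n := by
  rw [degree_eq_natDegree (hQ.1 n).1.ne_zero, (hQ.1 n).2]

theorem IsSMOP.coeff_self (hQ : IsSMOP u Q) (n : ℕ) : (Q n).coeff n = 1 := by
  have := (hQ.1 n).1.coeff_natDegree
  rwa [(hQ.1 n).2] at this

theorem degree_sub_lt_of_monic {p q : ℝ[X]} {n : ℕ} (hp : p.Monic) (hpn : p.natDegree = n)
    (hq : q.Monic) (hqn : q.natDegree = n) : (p - q).degree < n := by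
  have h1 : p.degree < (n + 1 : ℕ) := by
    rw [degree_eq_natDegree hp.ne_zero, hpn]; exact_mod_cast Nat.lt_succ_self n
  have h2 := degree_sub_C_mul_lt h1 hq hqn
  have : p.coeff n = 1 := by rw [← hpn]; exact hp
  simpa [this] using h2

/-- The difference `p - Q n` has degree below `n`, hence is orthogonal to itself, and positivity
makes it vanish. -/
theorem IsSMOP.eq_of_monic (hQ : IsSMOP u Q) (hpos : ∀ p : ℝ[X], p ≠ 0 → 0 < u (p * p))
    {p : ℝ[X]} {n : ℕ} (hp : p.Monic) (hpn : p.natDegree = n)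
    (h : ∀ q : ℝ[X], q.degree < n → u (p * q) = 0) : p = Q n := by
  refine sub_eq_zero.1 (eq_zero_of_forall_map_mul hpos
    (degree_sub_lt_of_monic hp hpn (hQ.1 n).1 (hQ.1 n).2) fun q hq => ?_)
  rw [sub_mul, map_sub, h q hq, hQ.map_mul_eq_zero hq, sub_zero]

theorem monicOP_monic_natDegree (u : ℝ[X] → ℝ) (n : ℕ) :
    (monicOP u n).Monic ∧ (monicOP u n).natDegree = n := by
  induction n using Nat.strong_induction_on with
  | _ n ih =>
    rw [monicOP]
    set s := ∑ k : Fin n,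
      C (u (X ^ n * monicOP u k) / u (monicOP u k * monicOP u k)) * monicOP u k with hs
    have hdeg : s.degree < n := by
      rw [degree_lt_iff_coeff_zero]
      intro m hm
      rw [hs, finsetSum_coeff]
      refine Finset.sum_eq_zero fun k _ => ?_
      rw [coeff_C_mul, coeff_eq_zero_of_natDegree_lt, mul_zero]
      rw [(ih k k.2).2]; omega
    have hm : (X ^ n - s).Monic := monic_X_pow_sub hdeg
    refine ⟨hm, natDegree_eq_of_degree_eq_some ?_⟩
    rw [degree_sub_eq_left_of_degree_lt (by rwa [degree_X_pow]), degree_X_pow]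

theorem isSMOP_monicOP (hpos : ∀ p : ℝ[X], p ≠ 0 → 0 < u (p * p)) : IsSMOP u (monicOP u) := by
  have hne : ∀ n, u (monicOP u n * monicOP u n) ≠ 0 := fun n =>
    (hpos _ (monicOP_monic_natDegree u n).1.ne_zero).ne'
  have key : ∀ n, ∀ m < n, u (monicOP u m * monicOP u n) = 0 := by
    intro n
    induction n using Nat.strong_induction_on with
    | _ n ih =>
      intro m hm
      rw [monicOP.eq_def u n, mul_sub, map_sub, Finset.mul_sum, map_sum,
        Finset.sum_eq_single (⟨m, hm⟩ : Fin n)]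
      · rw [mul_left_comm, ← smul_eq_C_mul, map_smul, smul_eq_mul, div_mul_cancel₀ _ (hne m),
          mul_comm, sub_self]
      · intro k _ hk
        rw [mul_left_comm, ← smul_eq_C_mul, map_smul, smul_eq_mul]
        have hk' : (k : ℕ) ≠ m := fun h => hk (Fin.ext h)
        rcases lt_or_gt_of_ne hk' with h | h
        · rw [mul_comm (monicOP u m), ih m hm k h, mul_zero]
        · rw [ih k k.2 m h, mul_zero]
      · simp
  refine ⟨monicOP_monic_natDegree u, fun m n hmn => ?_, hne⟩
  rcases lt_or_gt_of_ne hmn with h | h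
  · exact key n m h
  · rw [mul_comm]; exact key m n h

/-- By symmetry of `u`, the reflection times `(-1)^n` is again monic and orthogonal to lower
degrees, so uniqueness applies. -/
theorem IsSMOP.comp_neg_X (hQ : IsSMOP u Q) (hpos : ∀ p : ℝ[X], p ≠ 0 → 0 < u (p * p))
    (hsymm : ∀ p : ℝ[X], u (p.comp (-X)) = u p) (n : ℕ) :
    (Q n).comp (-X) = C ((-1) ^ n) * Q n := by
  have hsq : (C ((-1 : ℝ) ^ n) * C ((-1) ^ n)) = 1 := by
    rw [← C_mul, ← mul_pow]; simp
  have hdeg : ((Q n).comp (-X)).natDegree = n := by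
    rw [natDegree_comp, natDegree_neg, natDegree_X, (hQ.1 n).2, mul_one]
  have hlead : ((Q n).comp (-X)).leadingCoeff = (-1) ^ n := by
    rw [leadingCoeff_comp (by simp), (hQ.1 n).1.leadingCoeff, (hQ.1 n).2]; simp
  have h : C ((-1) ^ n) * (Q n).comp (-X) = Q n := by
    refine hQ.eq_of_monic hpos ?_ ?_ fun q hq => ?_
    · rw [Monic, leadingCoeff_mul, leadingCoeff_C, hlead, ← mul_pow]; simp
    · rw [natDegree_C_mul (by simp), hdeg]
    · rw [mul_assoc, ← smul_eq_C_mul, map_smul, ← hsymm, mul_comp, comp_assoc]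
      have : (-X : ℝ[X]).comp (-X) = X := by simp
      rw [this, comp_X, hQ.map_mul_eq_zero, smul_zero]
      rwa [degree_comp_neg_X]
  calc (Q n).comp (-X) = (C ((-1 : ℝ) ^ n) * C ((-1) ^ n)) * (Q n).comp (-X) := by rw [hsq, one_mul]
    _ = _ := by rw [mul_assoc, h]

theorem IsSMOP.map_X_mul_mul_self (hQ : IsSMOP u Q) (hpos : ∀ p : ℝ[X], p ≠ 0 → 0 < u (p * p))
    (hsymm : ∀ p : ℝ[X], u (p.comp (-X)) = u p) (n : ℕ) : u (X * Q n * Q n) = 0 := by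
  have h := hsymm (X * Q n * Q n)
  rw [mul_comp, mul_comp, hQ.comp_neg_X hpos hsymm, X_comp] at h
  have hsq : (C ((-1 : ℝ) ^ n) * C ((-1) ^ n)) = 1 := by
    rw [← C_mul, ← mul_pow]; simp
  have : -X * (C ((-1) ^ n) * Q n) * (C ((-1) ^ n) * Q n) =
    -((C ((-1 : ℝ) ^ n) * C ((-1) ^ n)) * (X * Q n * Q n)) := by ring
  rw [this, hsq, one_mul, map_neg] at h
  linarith

theorem degree_X_mul_lt {p : ℝ[X]} {n : ℕ} (hp : p.degree < n) :
    degree (X * p) < ((n + 1 : ℕ) : WithBot ℕ) := by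
  rw [degree_lt_iff_coeff_zero] at hp ⊢
  intro m hm
  obtain ⟨m, rfl⟩ : ∃ k, m = k + 1 := ⟨m - 1, by omega⟩
  rw [coeff_X_mul]
  exact hp m (by omega)

theorem IsSMOP.degree_lt (hQ : IsSMOP u Q) {n m : ℕ} (h : n < m) : (Q n).degree < m := by
  rw [hQ.degree_eq]; exact_mod_cast h

theorem IsSMOP.map_mul_X_mul_succ (hQ : IsSMOP u Q) (n : ℕ) :
    u (Q (n + 1) * (X * Q n)) = u (Q (n + 1) * Q (n + 1)) := by
  rw [hQ.map_mul_eq (degree_X_mul_lt (hQ.degree_lt (Nat.lt_succ_self n))), coeff_X_mul,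
    hQ.coeff_self, one_mul]

theorem IsSMOP.zero_eq (hQ : IsSMOP u Q) : Q 0 = 1 :=
  (hQ.1 0).1.natDegree_eq_zero.1 (hQ.1 0).2

theorem IsSMOP.one_eq (hQ : IsSMOP u Q) (hpos : ∀ p : ℝ[X], p ≠ 0 → 0 < u (p * p))
    (hsymm : ∀ p : ℝ[X], u (p.comp (-X)) = u p) : Q 1 = X := by
  refine (hQ.eq_of_monic hpos monic_X natDegree_X fun q hq => ?_).symm
  refine map_mul_eq_zero_of_forall hQ.1 (fun j hj => ?_) hq
  obtain rfl : j = 0 := by omega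
  have := hQ.map_X_mul_mul_self hpos hsymm 0
  simpa [hQ.zero_eq] using this

/-- The difference of the two sides has degree below `n + 2`, so it suffices to test it on `Q j`:
for `j < n` move `X` onto `Q j`, `j = n` forces the constant, and `j = n + 1` vanishes by parity. -/
theorem IsSMOP.recurrence (hQ : IsSMOP u Q) (hpos : ∀ p : ℝ[X], p ≠ 0 → 0 < u (p * p))
    (hsymm : ∀ p : ℝ[X], u (p.comp (-X)) = u p) (n : ℕ) :
    X * Q (n + 1) =
      Q (n + 2) + C (u (Q (n + 1) * Q (n + 1)) / u (Q n * Q n)) * Q n := by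
  set g := u (Q (n + 1) * Q (n + 1)) / u (Q n * Q n) with hg
  have hd : degree (X * Q (n + 1) - Q (n + 2) - C g * Q n) < ((n + 2 : ℕ) : WithBot ℕ) := by
    have h1 : degree (X * Q (n + 1) - Q (n + 2)) < ((n + 2 : ℕ) : WithBot ℕ) := by
      refine degree_sub_lt_of_monic (monic_X.mul (hQ.1 _).1) ?_ (hQ.1 _).1 (hQ.1 _).2
      rw [natDegree_X_mul (hQ.1 _).1.ne_zero, (hQ.1 _).2]
    refine (degree_sub_le _ _).trans_lt (max_lt h1 ?_)
    rw [← smul_eq_C_mul]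
    refine (degree_smul_le _ _).trans_lt (hQ.degree_lt (by omega))
  have := eq_zero_of_forall_map_mul hpos hd fun q hq => ?_
  · linear_combination this
  refine map_mul_eq_zero_of_forall hQ.1 (fun j hj => ?_) hq
  have e : (X * Q (n + 1) - Q (n + 2) - C g * Q n) * Q j =
    Q (n + 1) * (X * Q j) - Q (n + 2) * Q j - g • (Q n * Q j) := by
    rw [smul_eq_C_mul]; ring
  rw [e, map_sub, map_sub, map_smul, hQ.2.1 (n + 2) j (by omega)]
  rcases lt_trichotomy j n with h | rfl | h
  · rw [hQ.map_mul_eq_zero, hQ.2.1 n j (by omega)]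
    · simp
    · exact (degree_X_mul_lt (hQ.degree_lt h))
  · rw [hQ.map_mul_X_mul_succ, hg, smul_eq_mul, div_mul_cancel₀ _ (hQ.2.2 j)]; ring
  · obtain rfl : j = n + 1 := by omega
    rw [hQ.2.1 n (n + 1) (by omega)]
    have := hQ.map_X_mul_mul_self hpos hsymm (n + 1)
    rw [show Q (n + 1) * (X * Q (n + 1)) = X * Q (n + 1) * Q (n + 1) by ring, this]
    simp

end Orthogonal

/-! ### The Gauss–Rys functional: positivity, symmetry, `z`-derivative, Pearson equation. -/

section Functional

open MeasureTheory

/-- On `[0, 1]` the function factors as `(1 - x)^a (1 + x)^a`, where only the first factor can be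
singular; reflection handles `[-1, 0]`. -/
theorem intervalIntegrable_one_sub_sq_rpow {a : ℝ} (ha : -1 < a) :
    IntervalIntegrable (fun x : ℝ => (1 - x ^ 2) ^ a) volume (-1) 1 := by
  have h1 : IntervalIntegrable (fun x : ℝ => (1 - x ^ 2) ^ a) volume 0 1 := by
    have h2 : IntervalIntegrable (fun x : ℝ => (1 - x) ^ a) volume 0 1 := by
      have := (intervalIntegral.intervalIntegrable_rpow' (a := 1) (b := 0) ha).comp_sub_left 1
      simpa using this
    have h3 : ContinuousOn (fun x : ℝ => (1 + x) ^ a) (Set.uIcc 0 1) := by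
      rw [Set.uIcc_of_le zero_le_one]
      refine ContinuousOn.rpow_const (by fun_prop) fun x hx => Or.inl ?_
      linarith [hx.1]
    refine (h2.mul_continuousOn h3).congr fun x hx => ?_
    rw [Set.uIoc_of_le zero_le_one] at hx
    show (1 - x) ^ a * (1 + x) ^ a = (1 - x ^ 2) ^ a
    rw [← Real.mul_rpow (by linarith [hx.2]) (by linarith [hx.1])]
    congr 1; ring
  have h4 : IntervalIntegrable (fun x : ℝ => (1 - x ^ 2) ^ a) volume (-1) 0 := by
    have := (IntervalIntegrable.iff_comp_neg (f := fun x : ℝ => (1 - x ^ 2) ^ a)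
      (a := (0 : ℝ)) (b := 1)).1 h1
    simpa using this.symm
  exact h4.trans h1

variable {lam : ℝ}

theorem intervalIntegrable_mul_weight (hlam : -1 / 2 < lam) (z : ℝ) {g : ℝ → ℝ}
    (hg : Continuous g) :
    IntervalIntegrable
      (fun x => g x * ((1 - x ^ 2) ^ (lam - 1 / 2) * Real.exp (-z * x ^ 2))) volume (-1) 1 := by
  have h := intervalIntegrable_one_sub_sq_rpow (a := lam - 1 / 2) (by linarith)
  refine (h.continuousOn_mul (g := fun x => g x * Real.exp (-z * x ^ 2)) ?_).congr fun x _ => ?_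
  · exact Continuous.continuousOn (by fun_prop)
  · ring

/-- The generalized Gauss-Rys functional as a linear map. -/
def functionalLM (hlam : -1 / 2 < lam) (z : ℝ) : ℝ[X] →ₗ[ℝ] ℝ where
  toFun := functional lam z
  map_add' p q := by
    unfold functional
    rw [← intervalIntegral.integral_add (intervalIntegrable_mul_weight hlam z p.continuous)
      (intervalIntegrable_mul_weight hlam z q.continuous)]
    simp only [eval_add, add_mul]
  map_smul' c p := by
    unfold functional
    simp only [eval_smul, smul_eq_mul, mul_assoc, intervalIntegral.integral_const_mul,
      RingHom.id_apply]

theorem coe_functionalLM (hlam : -1 / 2 < lam) (z : ℝ) :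
    ⇑(functionalLM hlam z) = functional lam z := rfl

theorem functional_pos (hlam : -1 / 2 < lam) (z : ℝ) {p : ℝ[X]} (hp : p ≠ 0)
    (h : ∀ x ∈ Set.Ioo (-1 : ℝ) 1, 0 ≤ p.eval x) : 0 < functional lam z p := by
  unfold functional
  have hw : ∀ x ∈ Set.Ioo (-1 : ℝ) 1,
      0 < (1 - x ^ 2) ^ (lam - 1 / 2) * Real.exp (-z * x ^ 2) := fun x hx =>
    mul_pos (Real.rpow_pos_of_pos (by nlinarith [hx.1, hx.2]) _) (Real.exp_pos _)
  -- The integral is over `Ioc`, while the sign of `p` is assumed only on `Ioo`; the endpoint is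
  -- discarded as a null set.
  have hae : ∀ᵐ x : ℝ ∂volume, x ≠ 1 := by simp [ae_iff]
  have hnn : 0 ≤ᵐ[volume.restrict (Set.Ioc (-1 : ℝ) 1)]
      fun x => p.eval x * ((1 - x ^ 2) ^ (lam - 1 / 2) * Real.exp (-z * x ^ 2)) := by
    refine (ae_restrict_iff' measurableSet_Ioc).2 ?_
    filter_upwards [hae] with x hx hx'
    have hm : x ∈ Set.Ioo (-1 : ℝ) 1 := ⟨hx'.1, lt_of_le_of_ne hx'.2 hx⟩
    exact mul_nonneg (h x hm) (hw x hm).le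
  refine (intervalIntegral.integral_pos_iff_support_of_nonneg_ae' (by
    rwa [Set.uIoc_of_le (by norm_num)]) (intervalIntegrable_mul_weight hlam z p.continuous)).2
    ⟨by norm_num, ?_⟩
  have hsub : Set.Ioo (-1 : ℝ) 1 \ (p.roots.toFinset : Set ℝ) ⊆ Function.support
      (fun x => p.eval x * ((1 - x ^ 2) ^ (lam - 1 / 2) * Real.exp (-z * x ^ 2))) ∩
      Set.Ioc (-1) 1 := by
    rintro x ⟨hx, hr⟩
    refine ⟨mul_ne_zero (fun h0 => hr ?_) (hw x hx).ne', Set.Ioo_subset_Ioc_self hx⟩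
    simpa [hp] using h0
  refine lt_of_lt_of_le ?_ (measure_mono hsub)
  rw [measure_sdiff_null ((Finset.finite_toSet _).measure_zero _)]
  simp

theorem functional_mul_self_pos (hlam : -1 / 2 < lam) (z : ℝ) (p : ℝ[X]) (hp : p ≠ 0) :
    0 < functionalLM hlam z (p * p) :=
  functional_pos hlam z (mul_ne_zero hp hp) fun x _ => by
    rw [eval_mul]; exact mul_self_nonneg _

theorem functional_comp_neg_X (hlam : -1 / 2 < lam) (z : ℝ) (p : ℝ[X]) :
    functionalLM hlam z (p.comp (-X)) = functionalLM hlam z p := by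
  rw [coe_functionalLM]
  unfold functional
  have := intervalIntegral.integral_comp_neg (a := -1) (b := 1)
    (fun x => p.eval x * ((1 - x ^ 2) ^ (lam - 1 / 2) * Real.exp (-z * x ^ 2)))
  simpa using this

theorem hasDerivAt_functional (hlam : -1 / 2 < lam) {z : ℝ} (hz : 0 < z) (p : ℝ[X]) :
    HasDerivAt (fun t => functional lam t p) (-functional lam z (X ^ 2 * p)) z := by
  -- On the neighbourhood `Ioi 0` of `z` the exponential is at most `1`, so the weight at parameter
  -- `0` dominates uniformly.
  have key := (intervalIntegral.hasDerivAt_integral_of_dominated_loc_of_deriv_le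
    (F := fun t x => p.eval x * ((1 - x ^ 2) ^ (lam - 1 / 2) * Real.exp (-t * x ^ 2)))
    (F' := fun t x => (-(x ^ 2) * p.eval x) *
      ((1 - x ^ 2) ^ (lam - 1 / 2) * Real.exp (-t * x ^ 2)))
    (bound := fun x => |p.eval x| * ((1 - x ^ 2) ^ (lam - 1 / 2) * Real.exp (-0 * x ^ 2)))
    (a := -1) (b := 1) (μ := volume) (Ioi_mem_nhds hz)
    (Filter.Eventually.of_forall fun t =>
      ((intervalIntegrable_mul_weight hlam t p.continuous).def').aestronglyMeasurable)
    (intervalIntegrable_mul_weight hlam z p.continuous)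
    ((intervalIntegrable_mul_weight hlam z (g := fun x => -(x ^ 2) * p.eval x)
      (by fun_prop)).def').aestronglyMeasurable
    ?_ (intervalIntegrable_mul_weight hlam 0 (g := fun x => |p.eval x|) (by fun_prop)) ?_).2
  · refine HasDerivAt.congr_deriv key ?_
    unfold functional
    rw [← intervalIntegral.integral_neg]
    congr 1; ext x
    rw [eval_mul, eval_pow, eval_X]; ring
  · refine Filter.Eventually.of_forall fun x hx t ht => ?_
    rw [Set.uIoc_of_le (by norm_num)] at hx
    have hx2 : x ^ 2 ≤ 1 := by nlinarith [hx.1, hx.2]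
    have hr : 0 ≤ (1 - x ^ 2) ^ (lam - 1 / 2) := Real.rpow_nonneg (by linarith) _
    have he : Real.exp (-t * x ^ 2) ≤ 1 := by
      rw [Real.exp_le_one_iff]
      nlinarith [mul_nonneg (le_of_lt (Set.mem_Ioi.1 ht)) (sq_nonneg x)]
    rw [Real.norm_eq_abs, abs_mul, abs_mul, abs_neg, abs_of_nonneg (sq_nonneg x), abs_mul,
      abs_of_nonneg hr, abs_of_pos (Real.exp_pos _)]
    simp only [neg_zero, zero_mul, Real.exp_zero]
    have := abs_nonneg (p.eval x)
    gcongr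
    exact mul_le_of_le_one_left this hx2
  · refine Filter.Eventually.of_forall fun x _ t _ => ?_
    have h1 : HasDerivAt (fun s : ℝ => Real.exp (-s * x ^ 2))
        (Real.exp (-t * x ^ 2) * (-1 * x ^ 2)) t :=
      (((hasDerivAt_id t).neg).mul_const (x ^ 2)).exp
    refine ((h1.const_mul ((1 - x ^ 2) ^ (lam - 1 / 2))).const_mul (p.eval x)).congr_deriv ?_
    ring

/-- The integrand is the derivative of `p (1 - x²)^(lam + 1/2) exp(-z x²)`, which vanishes at `±1`
because `lam + 1/2 > 0`. -/
theorem functional_pearson (hlam : -1 / 2 < lam) (z : ℝ) (p : ℝ[X]) :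
    functionalLM hlam z ((1 - X ^ 2) * derivative p -
      (C (2 * lam + 1) * X + C (2 * z) * (X * (1 - X ^ 2))) * p) = 0 := by
  rw [coe_functionalLM]
  unfold functional
  rw [intervalIntegral.integral_eq_sub_of_hasDerivAt_of_le
    (f := fun x => p.eval x * ((1 - x ^ 2) ^ (lam + 1 / 2) * Real.exp (-z * x ^ 2)))
    (by norm_num) ?_ ?_ (intervalIntegrable_mul_weight hlam z (Polynomial.continuous _))]
  · have : (0 : ℝ) ^ (lam + 1 / 2) = 0 := Real.zero_rpow (by linarith)
    simp only [one_pow, neg_sq, sub_self, this]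
    simp
  · refine p.continuous.continuousOn.mul (ContinuousOn.mul ?_ (by fun_prop))
    exact ContinuousOn.rpow_const (by fun_prop) fun x hx => Or.inr (by linarith)
  · intro x hx
    have hx2 : 0 < 1 - x ^ 2 := by nlinarith [hx.1, hx.2]
    have h0 : HasDerivAt (fun x : ℝ => 1 - x ^ 2) (-(2 * x)) x := by
      simpa using (hasDerivAt_pow 2 x).const_sub 1
    have h1 := h0.rpow_const (p := lam + 1 / 2) (Or.inl hx2.ne')
    have h2 : HasDerivAt (fun x : ℝ => Real.exp (-z * x ^ 2))
        (Real.exp (-z * x ^ 2) * (-z * (2 * x))) x := by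
      simpa using ((hasDerivAt_pow 2 x).const_mul (-z)).exp
    refine ((p.hasDerivAt x).mul (h1.mul h2)).congr_deriv ?_
    have e1 : (1 - x ^ 2) ^ (lam + 1 / 2) = (1 - x ^ 2) ^ (lam - 1 / 2) * (1 - x ^ 2) := by
      rw [← Real.rpow_add_one hx2.ne']; congr 1; ring
    have e2 : lam + 1 / 2 - 1 = lam - 1 / 2 := by ring
    rw [e2]
    simp only [eval_sub, eval_mul, eval_add, eval_one, eval_pow, eval_X, eval_C, Pi.mul_apply]
    rw [e1]
    ring

end Functional

/-! ### Specialisation to the Gauss–Rys polynomials. -/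

section Basic

variable {lam : ℝ}

theorem isSMOP_P (hlam : -1 / 2 < lam) (z : ℝ) : IsSMOP (functionalLM hlam z) (P lam z) :=
  isSMOP_monicOP (functional_mul_self_pos hlam z)

theorem h_pos (hlam : -1 / 2 < lam) (z : ℝ) (n : ℕ) : 0 < h lam z n :=
  functional_mul_self_pos hlam z _ ((isSMOP_P hlam z).1 n).1.ne_zero

theorem γ_succ_pos (hlam : -1 / 2 < lam) (z : ℝ) (n : ℕ) : 0 < γ lam z (n + 1) :=
  div_pos (h_pos hlam z _) (h_pos hlam z _)

theorem h_succ (hlam : -1 / 2 < lam) (z : ℝ) (n : ℕ) :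
    h lam z (n + 1) = γ lam z (n + 1) * h lam z n :=
  (div_mul_cancel₀ _ (h_pos hlam z n).ne').symm

theorem P_zero (hlam : -1 / 2 < lam) (z : ℝ) : P lam z 0 = 1 := (isSMOP_P hlam z).zero_eq

theorem P_one (hlam : -1 / 2 < lam) (z : ℝ) : P lam z 1 = X :=
  (isSMOP_P hlam z).one_eq (functional_mul_self_pos hlam z) (functional_comp_neg_X hlam z)

theorem X_mul_P_succ (hlam : -1 / 2 < lam) (z : ℝ) (n : ℕ) :
    X * P lam z (n + 1) = P lam z (n + 2) + C (γ lam z (n + 1)) * P lam z n :=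
  (isSMOP_P hlam z).recurrence (functional_mul_self_pos hlam z) (functional_comp_neg_X hlam z) n

theorem P_comp_neg_X (hlam : -1 / 2 < lam) (z : ℝ) (n : ℕ) :
    (P lam z n).comp (-X) = C ((-1) ^ n) * P lam z n :=
  (isSMOP_P hlam z).comp_neg_X (functional_mul_self_pos hlam z) (functional_comp_neg_X hlam z) n

/-- Confluent Christoffel–Darboux: the recurrence gives `W_{n+1} = P_{n+1}² + γ_{n+1} W_n` with `W_0
= 1`. At a zero of `P_{n+1}` it shows that `P_{n+1}'` and `P_n` are nonzero of equal sign. -/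
theorem wronskian_pos (hlam : -1 / 2 < lam) (z : ℝ) (n : ℕ) (x : ℝ) :
    0 < (derivative (P lam z (n + 1))).eval x * (P lam z n).eval x -
      (derivative (P lam z n)).eval x * (P lam z (n + 1)).eval x := by
  induction n with
  | zero => simp [P_zero hlam, P_one hlam]
  | succ n ih =>
    have hr : P lam z (n + 2) = X * P lam z (n + 1) - C (γ lam z (n + 1)) * P lam z n := by
      rw [X_mul_P_succ hlam]; ring
    have e : (derivative (P lam z (n + 1 + 1))).eval x * (P lam z (n + 1)).eval x -
        (derivative (P lam z (n + 1))).eval x * (P lam z (n + 1 + 1)).eval x =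
        (P lam z (n + 1)).eval x ^ 2 + γ lam z (n + 1) *
        ((derivative (P lam z (n + 1))).eval x * (P lam z n).eval x -
          (derivative (P lam z n)).eval x * (P lam z (n + 1)).eval x) := by
      rw [hr]
      simp only [derivative_sub, derivative_mul, derivative_X, derivative_C, eval_sub, eval_mul,
        eval_add, eval_X, eval_C, eval_one, eval_zero]
      ring
    rw [e]
    have := mul_pos (γ_succ_pos hlam z n) ih
    positivity

end Basic

/-! ### Dependence of the polynomials on `z`. -/

section ParameterDerivative

variable {lam : ℝ}

theorem hasDerivAt_eval_of_coeff {p : ℝ → ℝ[X]} {D : ℝ[X]} {N : ℕ} {z : ℝ}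
    (hp : ∀ t, (p t).natDegree < N) (hD : D.natDegree < N)
    (h : ∀ i, HasDerivAt (fun t => (p t).coeff i) (D.coeff i) z) (x : ℝ) :
    HasDerivAt (fun t => (p t).eval x) (D.eval x) z := by
  simp only [fun t => eval_eq_sum_range' (hp t) x, eval_eq_sum_range' hD x]
  exact HasDerivAt.fun_sum fun i _ => (h i).mul_const _

/-- Product rule: `t` enters through the polynomial and through the weight. The uniform degree bound
`N` turns both into finite sums over moments. -/
theorem hasDerivAt_functional_of_coeff (hlam : -1 / 2 < lam) {p : ℝ → ℝ[X]} {D : ℝ[X]} {N : ℕ}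
    {z : ℝ} (hz : 0 < z) (hp : ∀ t, (p t).natDegree < N) (hD : D.natDegree < N)
    (h : ∀ i, HasDerivAt (fun t => (p t).coeff i) (D.coeff i) z) :
    HasDerivAt (fun t => functional lam t (p t))
      (functional lam z D - functional lam z (X ^ 2 * p z)) z := by
  have hexp : ∀ (t : ℝ) (r q : ℝ[X]), q.natDegree < N → functional lam t (r * q) =
      ∑ i ∈ Finset.range N, q.coeff i * functional lam t (r * X ^ i) := by
    intro t r q hq
    rw [← coe_functionalLM hlam t]
    conv_lhs => rw [q.as_sum_range' N hq, Finset.mul_sum, map_sum]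
    refine Finset.sum_congr rfl fun i _ => ?_
    rw [← C_mul_X_pow_eq_monomial, mul_left_comm, ← smul_eq_C_mul, map_smul, smul_eq_mul]
  have hexp1 : ∀ (t : ℝ) (q : ℝ[X]), q.natDegree < N → functional lam t q =
      ∑ i ∈ Finset.range N, q.coeff i * functional lam t (X ^ i) := by
    intro t q hq
    simpa using hexp t 1 q hq
  rw [hexp1 z D hD, hexp z _ _ (hp z), ← Finset.sum_sub_distrib]
  simp only [fun t => hexp1 t _ (hp t)]
  refine HasDerivAt.fun_sum fun i _ => ?_
  refine ((h i).mul (hasDerivAt_functional hlam hz (X ^ i))).congr_deriv ?_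
  ring

theorem hasDerivAt_coeff_X_pow_mul {p : ℝ → ℝ[X]} {D : ℝ[X]} {z : ℝ}
    (h : ∀ i, HasDerivAt (fun t => (p t).coeff i) (D.coeff i) z) (m i : ℕ) :
    HasDerivAt (fun t => (X ^ m * p t).coeff i) ((X ^ m * D).coeff i) z := by
  simp only [coeff_X_pow_mul']
  split_ifs
  · exact h _
  · exact hasDerivAt_const _ _

/-- The leading coefficient is constantly `1`, so the derivative drops in degree; this is what lets
orthogonality determine it. -/
theorem exists_hasDerivAt_coeff (hlam : -1 / 2 < lam) {n : ℕ} {z : ℝ}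
    (h : ∀ i, DifferentiableAt ℝ (fun t => (P lam t n).coeff i) z) :
    ∃ D : ℝ[X], D.degree < n ∧ ∀ i, HasDerivAt (fun t => (P lam t n).coeff i) (D.coeff i) z := by
  refine ⟨∑ i ∈ Finset.range n, monomial i (deriv (fun t => (P lam t n).coeff i) z), ?_, ?_⟩
  · rw [degree_lt_iff_coeff_zero]
    intro m hm
    simp only [finsetSum_coeff, coeff_monomial]
    refine Finset.sum_eq_zero fun i hi => if_neg ?_
    have := Finset.mem_range.1 hi
    omega
  · intro i
    simp only [finsetSum_coeff, coeff_monomial, Finset.sum_ite_eq', Finset.mem_range]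
    split_ifs with hi
    · exact (h i).hasDerivAt
    · have : (fun t => (P lam t n).coeff i) = fun _ => if i = n then 1 else 0 := by
        funext t
        split_ifs with h'
        · rw [h', (isSMOP_P hlam t).coeff_self]
        · exact coeff_eq_zero_of_natDegree_lt (by rw [((isSMOP_P hlam t).1 n).2]; omega)
      rw [this]
      exact hasDerivAt_const _ _

theorem natDegree_lt_of_degree_lt {p : ℝ[X]} {n m : ℕ} (hp : p.degree < n) (h : n < m) :
    p.natDegree < m :=
  (natDegree_le_of_degree_le hp.le).trans_lt h

theorem natDegree_X_pow_mul_P (hlam : -1 / 2 < lam) (t : ℝ) (m n : ℕ) :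
    (X ^ m * P lam t n).natDegree = m + n := by
  rw [(monic_X_pow m).natDegree_mul ((isSMOP_P hlam t).1 n).1, natDegree_X_pow,
    ((isSMOP_P hlam t).1 n).2]

theorem hasDerivAt_functional_X_pow_mul_P (hlam : -1 / 2 < lam) {z : ℝ} (hz : 0 < z) {n : ℕ}
    {D : ℝ[X]} (hD : D.degree < n)
    (h : ∀ i, HasDerivAt (fun t => (P lam t n).coeff i) (D.coeff i) z) (m : ℕ) :
    HasDerivAt (fun t => functional lam t (X ^ m * P lam t n))
      (functional lam z (X ^ m * D) - functional lam z (X ^ 2 * (X ^ m * P lam z n))) z := by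
  refine hasDerivAt_functional_of_coeff hlam (N := m + n + 1) hz (fun t => ?_) ?_
    (hasDerivAt_coeff_X_pow_mul h m)
  · rw [natDegree_X_pow_mul_P hlam]; omega
  · refine lt_of_le_of_lt natDegree_mul_le ?_
    have := natDegree_lt_of_degree_lt hD (Nat.lt_succ_self n)
    rw [natDegree_X_pow]
    omega

theorem differentiableAt_h (hlam : -1 / 2 < lam) {z : ℝ} (hz : 0 < z) {n : ℕ}
    (hn : ∀ i, DifferentiableAt ℝ (fun t => (P lam t n).coeff i) z) :
    DifferentiableAt ℝ (fun t => h lam t n) z := by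
  obtain ⟨D, hD, hd⟩ := exists_hasDerivAt_coeff hlam hn
  -- Pairing with `X ^ n` instead of `P_n` gives the same norm and is linear in the coefficients of
  -- `P_n`.
  have e : (fun t => h lam t n) = fun t => functional lam t (X ^ n * P lam t n) := by
    funext t
    have := (isSMOP_P hlam t).map_mul_eq (n := n) (q := X ^ n) (by
      rw [degree_X_pow]; exact_mod_cast Nat.lt_succ_self n)
    rw [coeff_X_pow_self, one_mul, mul_comm, coe_functionalLM] at this
    exact this.symm
  rw [e]
  exact (hasDerivAt_functional_X_pow_mul_P hlam hz hD hd n).differentiableAt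

theorem differentiableAt_P_coeff (hlam : -1 / 2 < lam) {z : ℝ} (hz : 0 < z) (n i : ℕ) :
    DifferentiableAt ℝ (fun t => (P lam t n).coeff i) z := by
  induction n using Nat.strong_induction_on generalizing i with
  | _ n ih =>
    match n with
    | 0 => simp only [P_zero hlam]; exact differentiableAt_const _
    | 1 => simp only [P_one hlam]; exact differentiableAt_const _
    | n + 2 =>
      have e : (fun t => (P lam t (n + 2)).coeff i) = fun t => (X ^ 1 * P lam t (n + 1)).coeff i -
          h lam t (n + 1) / h lam t n * (P lam t n).coeff i := by
        funext t
        have := congrArg (fun p => p.coeff i) (X_mul_P_succ hlam t n)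
        simp only [coeff_add, coeff_C_mul, γ] at this
        rw [pow_one]
        linarith
      rw [e]
      obtain ⟨D, -, hd⟩ := exists_hasDerivAt_coeff hlam (ih (n + 1) (by omega))
      exact (hasDerivAt_coeff_X_pow_mul hd 1 i).differentiableAt.sub
        (((differentiableAt_h hlam hz (ih (n + 1) (by omega))).div
          (differentiableAt_h hlam hz (ih n (by omega))) (h_pos hlam z n).ne').mul
          (ih n (by omega) i))

theorem degree_X_mul_P_sub_lt (hlam : -1 / 2 < lam) (z : ℝ) (n : ℕ) :
    degree (X * P lam z n - P lam z (n + 1)) < ((n + 1 : ℕ) : WithBot ℕ) := by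
  have hP := (isSMOP_P hlam z).1
  refine degree_sub_lt_of_monic (monic_X.mul (hP n).1) ?_ (hP _).1 (hP _).2
  rw [natDegree_X_mul (hP n).1.ne_zero, (hP n).2]

/-- Writing `X P_n - P_{n+1}` in place of `γ_n P_{n-1}` includes `n = 0` without a polynomial of
negative index. Both sides have degree at most `n` and the same pairings with `X ^ j` for `j ≤ n`.
-/
theorem hasDerivAt_P_coeff (hlam : -1 / 2 < lam) {z : ℝ} (hz : 0 < z) (n i : ℕ) :
    HasDerivAt (fun t => (P lam t (n + 1)).coeff i)
      ((C (γ lam z (n + 1)) * (X * P lam z n - P lam z (n + 1))).coeff i) z := by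
  obtain ⟨D, hD, hd⟩ := exists_hasDerivAt_coeff hlam (differentiableAt_P_coeff hlam hz (n + 1))
  have hS := isSMOP_P hlam z
  suffices D = C (γ lam z (n + 1)) * (X * P lam z n - P lam z (n + 1)) by
    rw [← this]; exact hd i
  refine sub_eq_zero.1 (eq_zero_of_forall_map_mul (u := functionalLM hlam z) (n := n + 1)
    (functional_mul_self_pos hlam z) ?_ fun q hq => ?_)
  · refine (degree_sub_le _ _).trans_lt (max_lt hD ?_)
    rw [← smul_eq_C_mul]
    exact (degree_smul_le _ _).trans_lt (degree_X_mul_P_sub_lt hlam z n)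
  refine map_mul_eq_zero_of_forall (Q := fun j => X ^ j)
    (fun j => ⟨monic_X_pow j, natDegree_X_pow j⟩) (fun j hj => ?_) hq
  have hXj : ∀ m > j, degree (X ^ j : ℝ[X]) < m := fun m hm => by
    rw [degree_X_pow]; exact_mod_cast hm
  -- Differentiate the identity `⟨X^j, P_{n+1}⟩ = 0`, valid for all parameters.
  have h1 : functional lam z (X ^ j * D) =
      functional lam z (X ^ 2 * (X ^ j * P lam z (n + 1))) := by
    have h2 := hasDerivAt_functional_X_pow_mul_P hlam hz hD hd j
    have h3 : (fun t => functional lam t (X ^ j * P lam t (n + 1))) = fun _ => 0 := by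
      funext t
      rw [mul_comm]
      exact (isSMOP_P hlam t).map_mul_eq_zero (hXj _ hj)
    rw [h3] at h2
    linarith [h2.unique (hasDerivAt_const z (0 : ℝ))]
  rw [← coe_functionalLM hlam] at h1
  have e1 : (D - C (γ lam z (n + 1)) * (X * P lam z n - P lam z (n + 1))) * X ^ j =
      X ^ j * D - γ lam z (n + 1) • (P lam z n * (X * X ^ j)) +
        γ lam z (n + 1) • (P lam z (n + 1) * X ^ j) := by
    simp only [smul_eq_C_mul]; ring
  have e2 : X ^ 2 * (X ^ j * P lam z (n + 1)) = P lam z (n + 2) * (X * X ^ j) +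
      γ lam z (n + 1) • (P lam z n * (X * X ^ j)) := by
    rw [smul_eq_C_mul]
    linear_combination (X * X ^ j) * X_mul_P_succ hlam z n
  rw [e1, map_add, map_sub, map_smul, map_smul, h1, e2, map_add, map_smul,
    hS.map_mul_eq_zero (hXj _ hj), hS.map_mul_eq_zero (degree_X_mul_lt (hXj _ hj))]
  simp

theorem hasDerivAt_P_eval (hlam : -1 / 2 < lam) {z : ℝ} (hz : 0 < z) (n : ℕ) (x : ℝ) :
    HasDerivAt (fun t => (P lam t (n + 1)).eval x)
      (γ lam z (n + 1) * (x * (P lam z n).eval x - (P lam z (n + 1)).eval x)) z := by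
  have := hasDerivAt_eval_of_coeff (N := n + 2)
    (fun t => by rw [((isSMOP_P hlam t).1 (n + 1)).2]; omega) ?_ (hasDerivAt_P_coeff hlam hz n) x
  · simpa using this
  · refine natDegree_lt_of_degree_lt (n := n + 1) ?_ (by omega)
    rw [← smul_eq_C_mul]
    exact (degree_smul_le _ _).trans_lt (degree_X_mul_P_sub_lt hlam z n)

end ParameterDerivative

/-! ### The structure relation and its value at a zero. -/

section Structure

variable {lam : ℝ}

/-- Pearson for `P_{n+1} q` produces the cubic term `-2z X³ P_{n+1} q`. The summand `2zγ X² P_n` is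
there to absorb part of it: by the recurrence only `-2z X² P_{n+2} q` remains, which pairs to zero
with low degrees. -/
theorem map_one_sub_X_sq_mul_derivative_mul (hlam : -1 / 2 < lam) (z : ℝ) (n : ℕ) (a : ℝ)
    (q : ℝ[X]) :
    functionalLM hlam z (((1 - X ^ 2) * derivative (P lam z (n + 1)) +
      C (n + 1 : ℝ) * P lam z (n + 2) - C a * P lam z n +
      C (2 * z * γ lam z (n + 1)) * (X ^ 2 * P lam z n - X * P lam z (n + 1))) * q) =
    (2 * lam + 1 + 2 * z - 2 * z * γ lam z (n + 1)) *
        functionalLM hlam z (P lam z (n + 1) * (X * q)) -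
      2 * z * functionalLM hlam z (P lam z (n + 2) * (X * (X * q))) -
      functionalLM hlam z (P lam z (n + 1) * ((1 - X ^ 2) * derivative q)) +
      (n + 1) * functionalLM hlam z (P lam z (n + 2) * q) -
      a * functionalLM hlam z (P lam z n * q) := by
  have h := functional_pearson hlam z (P lam z (n + 1) * q)
  rw [derivative_mul] at h
  simp only [← smul_eq_mul (a := (_ : ℝ)), ← map_smul, ← map_sub, ← map_add]
  rw [← sub_eq_zero, ← map_sub, ← h]
  congr 1
  simp only [smul_eq_C_mul, smul_eq_mul, map_sub, map_add, map_mul, map_one]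
  linear_combination (- C 2 * C z * X ^ 2 * q) * X_mul_P_succ hlam z n

theorem map_eq_zero_of_comp_neg_X (hlam : -1 / 2 < lam) (z : ℝ) {p : ℝ[X]}
    (hp : p.comp (-X) = -p) : functionalLM hlam z p = 0 := by
  have := functional_comp_neg_X hlam z p
  rw [hp, map_neg] at this
  linarith

theorem derivative_P_comp_neg_X (hlam : -1 / 2 < lam) (z : ℝ) (n : ℕ) :
    (derivative (P lam z n)).comp (-X) = - (C ((-1) ^ n) * derivative (P lam z n)) := by
  have := congrArg derivative (P_comp_neg_X hlam z n)
  rw [derivative_comp, derivative_C_mul, derivative_neg, derivative_X] at this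
  linear_combination -this

theorem C_neg_one_pow_mul_self (n : ℕ) : C ((-1 : ℝ) ^ n) * C ((-1 : ℝ) ^ n) = 1 := by
  rw [← C_mul, ← mul_pow]; simp

/-- The top coefficients cancel, so testing on `P_j` with `j < n + 2` suffices: `j < n` is
orthogonality, `j = n` fixes the coefficient of `P_n`, and `j = n + 1` is parity. -/
theorem structure_relation (hlam : -1 / 2 < lam) (z : ℝ) (n : ℕ) :
    (1 - X ^ 2) * derivative (P lam z (n + 1)) + C (n + 1 : ℝ) * P lam z (n + 2) -
      C (γ lam z (n + 1) * (n + 1 + 2 * lam + 2 * z -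
        2 * z * (γ lam z (n + 1) + γ lam z (n + 2)))) * P lam z n +
      C (2 * z * γ lam z (n + 1)) * (X ^ 2 * P lam z n - X * P lam z (n + 1)) = 0 := by
  have hS := isSMOP_P hlam z
  have hzero : ∀ m k, m < k → (P lam z m).coeff k = 0 := fun m k hk =>
    coeff_eq_zero_of_natDegree_lt (by rw [(hS.1 m).2]; exact hk)
  refine eq_zero_of_forall_map_mul (u := functionalLM hlam z) (n := n + 2)
    (functional_mul_self_pos hlam z) ?_ fun q hq => ?_
  · rw [degree_lt_iff_coeff_zero]
    intro m hm
    obtain ⟨k, rfl⟩ : ∃ k, m = k + 2 := ⟨m - 2, by omega⟩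
    simp only [sub_mul, one_mul, coeff_add, coeff_sub, coeff_C_mul, coeff_X_pow_mul,
      coeff_derivative, coeff_X_mul]
    rw [hzero (n + 1) (k + 2 + 1) (by omega), hzero n (k + 2) (by omega)]
    rcases (show n ≤ k by omega).eq_or_lt with rfl | hlt
    · rw [hS.coeff_self, hS.coeff_self, hS.coeff_self]; push_cast; ring
    · rw [hzero (n + 1) (k + 1) (by omega), hzero n k hlt, hzero (n + 2) (k + 2) (by omega)]
      ring
  refine map_mul_eq_zero_of_forall hS.1 (fun j hj => ?_) hq
  rw [map_one_sub_X_sq_mul_derivative_mul]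
  have hd : ∀ k ≥ j + 2,
      ((1 - X ^ 2) * derivative (P lam z j) : ℝ[X]).coeff k = 0 := by
    intro m hm
    obtain ⟨k, rfl⟩ : ∃ k, m = k + 2 := ⟨m - 2, by omega⟩
    simp only [sub_mul, one_mul, coeff_sub, coeff_X_pow_mul, coeff_derivative]
    rw [hzero j (k + 2 + 1) (by omega), hzero j (k + 1) (by omega)]
    ring
  rcases lt_trichotomy j n with hjn | rfl | hjn
  · rw [hS.map_mul_eq_zero (degree_X_mul_lt (hS.degree_lt hjn)),
      hS.map_mul_eq_zero (degree_X_mul_lt (degree_X_mul_lt (hS.degree_lt hjn))),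
      hS.2.1 _ _ (by omega : n + 2 ≠ j), hS.2.1 _ _ hjn.ne', hS.map_mul_eq_zero]
    · ring
    · rw [degree_lt_iff_coeff_zero]
      exact fun k hk => hd k (by omega)
  · rw [hS.map_mul_X_mul_succ, hS.2.1 _ _ (by omega : j + 2 ≠ j),
      hS.map_mul_eq (q := X * (X * P lam z j))
        (degree_X_mul_lt (degree_X_mul_lt (hS.degree_lt (Nat.lt_succ_self j)))),
      hS.map_mul_eq (q := (1 - X ^ 2) * derivative (P lam z j))]
    · have hc : ((1 - X ^ 2) * derivative (P lam z j) : ℝ[X]).coeff (j + 1) = -j := by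
        simp only [sub_mul, one_mul, coeff_sub, coeff_derivative]
        rw [hzero j (j + 1 + 1) (by omega)]
        cases j with
        | zero => simp [coeff_X_pow_mul']
        | succ j => rw [show j + 1 + 1 = j + 2 from rfl, coeff_X_pow_mul, coeff_derivative,
            hS.coeff_self]; push_cast; ring
      rw [hc, coeff_X_mul, coeff_X_mul, hS.coeff_self]
      have h1 := h_succ hlam z j
      have h2 := h_succ hlam z (j + 1)
      simp only [coe_functionalLM]
      change _ * h lam z (j + 1) - 2 * z * (1 * h lam z (j + 2)) - -(j : ℝ) * h lam z (j + 1) +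
        _ - _ * h lam z j = 0
      rw [h2, h1]
      ring
    · rw [degree_lt_iff_coeff_zero]
      exact fun k hk => hd k (by omega)
  · obtain rfl : j = n + 1 := by omega
    have hsq := C_neg_one_pow_mul_self (n + 1)
    have hs : C ((-1 : ℝ) ^ (n + 2)) = - C ((-1 : ℝ) ^ (n + 1)) := by
      rw [← C_neg]; congr 1; ring
    rw [hS.2.1 _ _ (by omega : n + 2 ≠ n + 1), hS.2.1 _ _ (by omega : n ≠ n + 1),
      map_eq_zero_of_comp_neg_X, map_eq_zero_of_comp_neg_X, map_eq_zero_of_comp_neg_X]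
    · ring
    · simp only [mul_comp, sub_comp, one_comp, pow_comp, X_comp, P_comp_neg_X hlam,
        derivative_P_comp_neg_X hlam]
      linear_combination (-(1 - X ^ 2) * P lam z (n + 1) * derivative (P lam z (n + 1))) * hsq
    · simp only [mul_comp, X_comp, P_comp_neg_X hlam, hs]
      linear_combination (-(X ^ 2) * P lam z (n + 1) * P lam z (n + 2)) * hsq
    · simp only [mul_comp, X_comp, P_comp_neg_X hlam]
      linear_combination (-X * P lam z (n + 1) * P lam z (n + 1)) * hsq

/-- At a zero of `P_{n+1}` the recurrence turns `P_{n+2}` into `-γ_{n+1} P_n`, so every remaining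
term is a multiple of `P_n`. -/
theorem derivative_P_eval_of_isRoot (hlam : -1 / 2 < lam) {z : ℝ} (hz : 0 < z) {n : ℕ} {x : ℝ}
    (hx : (P lam z (n + 1)).eval x = 0) :
    (1 - x ^ 2) * (derivative (P lam z (n + 1))).eval x =
      2 * z * γ lam z (n + 1) * (betaSq lam z (n + 1) - x ^ 2) * (P lam z n).eval x := by
  have h1 := congrArg (eval x) (structure_relation hlam z n)
  have h2 := congrArg (eval x) (X_mul_P_succ hlam z n)
  simp only [eval_mul, eval_add, eval_sub, eval_pow, eval_X, eval_C, eval_one, eval_zero, hx]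
    at h1 h2
  have h3 : z * betaSq lam z (n + 1) =
      n + 1 + lam + z - z * (γ lam z (n + 1) + γ lam z (n + 2)) := by
    unfold betaSq
    push_cast
    field_simp
  linear_combination h1 + (n + 1 : ℝ) * h2 - 2 * γ lam z (n + 1) * (P lam z n).eval x * h3

theorem betaSq_sub_sq_pos (hlam : -1 / 2 < lam) {z : ℝ} (hz : 0 < z) {n : ℕ} {x : ℝ}
    (hx : (P lam z (n + 1)).eval x = 0) (hx1 : x ∈ Set.Ioo (-1 : ℝ) 1) :
    0 < betaSq lam z (n + 1) - x ^ 2 := by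
  have hw := wronskian_pos hlam z n x
  rw [hx, mul_zero, sub_zero] at hw
  have h1 := derivative_P_eval_of_isRoot hlam hz hx
  have hx2 : 0 < 1 - x ^ 2 := by nlinarith [hx1.1, hx1.2]
  have hg := γ_succ_pos hlam z n
  have hb : (P lam z n).eval x ≠ 0 := right_ne_zero_of_mul hw.ne'
  have h2 : 0 < (betaSq lam z (n + 1) - x ^ 2) *
      (2 * z * γ lam z (n + 1) * (P lam z n).eval x ^ 2) := by
    refine (mul_pos hx2 hw).trans_eq ?_
    linear_combination (P lam z n).eval x * h1
  exact pos_of_mul_pos_left h2 (by positivity)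

end Structure

/-! ### Location, continuity and differential equation of the zeros. -/

section Zeros

open Filter Topology

variable {lam : ℝ}

/-- If `P_n = f q`, then `⟨P_n, q⟩ = 0` by degree, yet it is the integral of `f q²`. Suitable `f`
exclude zeros outside the interval, double zeros and factors without real roots. -/
theorem not_dvd_P_of_nonneg (hlam : -1 / 2 < lam) (z : ℝ) (n : ℕ) {f : ℝ[X]}
    (hf : f.natDegree ≠ 0) (hnn : ∀ x ∈ Set.Ioo (-1 : ℝ) 1, 0 ≤ f.eval x) :
    ¬ f ∣ P lam z n := by
  rintro ⟨q, hq⟩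
  have hS := isSMOP_P hlam z
  have hne : f * q ≠ 0 := hq ▸ (hS.1 n).1.ne_zero
  have hf0 := left_ne_zero_of_mul hne
  have hq0 := right_ne_zero_of_mul hne
  have hdeg : n = f.natDegree + q.natDegree := by
    rw [← natDegree_mul hf0 hq0, ← hq, (hS.1 n).2]
  have h1 : functionalLM hlam z (P lam z n * q) = 0 := by
    refine hS.map_mul_eq_zero ?_
    rw [degree_eq_natDegree hq0]
    exact_mod_cast (by omega : q.natDegree < n)
  refine (functional_pos hlam z (p := f * (q * q)) (mul_ne_zero hf0 (mul_ne_zero hq0 hq0))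
    fun x hx => ?_).ne' ?_
  · rw [eval_mul, eval_mul]
    exact mul_nonneg (hnn x hx) (mul_self_nonneg _)
  · rw [← mul_assoc, ← hq]
    exact h1

theorem isRoot_P_mem_Ioo (hlam : -1 / 2 < lam) {z : ℝ} {n : ℕ} {x : ℝ}
    (hx : (P lam z n).IsRoot x) : x ∈ Set.Ioo (-1 : ℝ) 1 := by
  have hd := dvd_iff_isRoot.2 hx
  by_contra hout
  rw [Set.mem_Ioo, not_and_or, not_lt, not_lt] at hout
  rcases hout with h | h
  · refine not_dvd_P_of_nonneg hlam z n (by simp) (fun y hy => ?_) hd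
    rw [eval_sub, eval_X, eval_C]
    linarith [hy.1]
  · refine not_dvd_P_of_nonneg hlam z n (f := -(X - C x)) (by rw [natDegree_neg]; simp)
      (fun y hy => ?_) (neg_dvd.2 hd)
    rw [eval_neg, eval_sub, eval_X, eval_C]
    linarith [hy.2]

theorem nodup_roots_P (hlam : -1 / 2 < lam) (z : ℝ) (n : ℕ) : (P lam z n).roots.Nodup := by
  rw [Multiset.nodup_iff_count_le_one]
  intro x
  rw [count_roots]
  by_contra h
  have h2 := (le_rootMultiplicity_iff ((isSMOP_P hlam z).1 n).1.ne_zero).1 (not_le.1 h)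
  refine not_dvd_P_of_nonneg hlam z n (by simp [natDegree_pow]) (fun y _ => ?_) h2
  rw [eval_pow]
  exact sq_nonneg _

theorem splits_P (hlam : -1 / 2 < lam) (z : ℝ) (n : ℕ) : (P lam z n).Splits := by
  rw [splits_iff_splits]
  refine Or.inr fun {g} hg hgd => ?_
  by_contra h1
  have hroot : ∀ x, g.eval x ≠ 0 := fun x hx =>
    h1 (degree_eq_one_of_irreducible_of_root hg hx)
  have hdeg : g.natDegree ≠ 0 := hg.natDegree_pos.ne'
  -- A rootless `g` has constant sign, so `g` or `-g` is a forbidden divisor.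
  by_cases hpos : ∀ x ∈ Set.Ioo (-1 : ℝ) 1, 0 ≤ g.eval x
  · exact not_dvd_P_of_nonneg hlam z n hdeg hpos hgd
  · push Not at hpos
    obtain ⟨x, -, hx⟩ := hpos
    refine not_dvd_P_of_nonneg hlam z n (f := -g) (by rwa [natDegree_neg]) (fun y _ => ?_)
      (neg_dvd.2 hgd)
    rw [eval_neg, neg_nonneg]
    by_contra hy
    obtain ⟨w, hw⟩ := mem_range_of_exists_le_of_exists_ge g.continuous ⟨x, hx.le⟩
      ⟨y, (not_le.1 hy).le⟩
    exact hroot w hw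

theorem card_roots_P (hlam : -1 / 2 < lam) (z : ℝ) (n : ℕ) : (P lam z n).roots.card = n := by
  rw [← (splits_P hlam z n).natDegree_eq_card_roots, ((isSMOP_P hlam z).1 n).2]

theorem zero_eq_getElem (hlam : -1 / 2 < lam) (z : ℝ) {n k : ℕ} (hk : k < n) :
    zero lam n k z = ((P lam z n).roots.sort (· ≤ ·))[k]'(by
      rw [Multiset.length_sort, card_roots_P hlam]; exact hk) := by
  unfold zero
  rw [List.getD_eq_getElem]

theorem strictMono_zero (hlam : -1 / 2 < lam) (z : ℝ) (n : ℕ) :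
    StrictMono (fun k : Fin n => zero lam n k z) := by
  have hlt : ((P lam z n).roots.sort (· ≤ ·)).SortedLT := by
    refine List.sortedLT_iff_nodup_and_sortedLE.2
      ⟨?_, (Multiset.pairwise_sort _ _).sortedLE⟩
    rw [← Multiset.coe_nodup, Multiset.sort_eq]
    exact nodup_roots_P hlam z n
  intro i j hij
  simp only [zero_eq_getElem hlam z i.2, zero_eq_getElem hlam z j.2]
  exact hlt.getElem_lt_getElem_of_lt hij

theorem isRoot_P_iff (hlam : -1 / 2 < lam) (z : ℝ) (n : ℕ) (x : ℝ) :
    (P lam z n).IsRoot x ↔ ∃ k : Fin n, x = zero lam n k z := by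
  rw [← mem_roots ((isSMOP_P hlam z).1 n).1.ne_zero, ← Multiset.mem_sort (· ≤ ·),
    List.mem_iff_getElem]
  constructor
  · rintro ⟨k, hk, rfl⟩
    rw [Multiset.length_sort, card_roots_P hlam] at hk
    exact ⟨⟨k, hk⟩, (zero_eq_getElem hlam z hk).symm⟩
  · rintro ⟨k, rfl⟩
    exact ⟨k, _, (zero_eq_getElem hlam z k.2).symm⟩

theorem eval_P_zero (hlam : -1 / 2 < lam) (z : ℝ) {n : ℕ} (k : Fin n) :
    (P lam z n).eval (zero lam n k z) = 0 :=
  (isRoot_P_iff hlam z n _).2 ⟨k, rfl⟩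

theorem zero_mem_Ioo (hlam : -1 / 2 < lam) (z : ℝ) {n : ℕ} (k : Fin n) :
    zero lam n k z ∈ Set.Ioo (-1 : ℝ) 1 :=
  isRoot_P_mem_Ioo hlam (eval_P_zero hlam z k)

theorem eq_zero_of_strictMono (hlam : -1 / 2 < lam) (z : ℝ) {n : ℕ} {f : Fin n → ℝ}
    (hf : StrictMono f) (hr : ∀ k, (P lam z n).IsRoot (f k)) (k : Fin n) :
    f k = zero lam n k z := by
  have hne := ((isSMOP_P hlam z).1 n).1.ne_zero
  have hcard : (P lam z n).roots.toFinset.card = n := by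
    rw [Multiset.toFinset_card_of_nodup (nodup_roots_P hlam z n), card_roots_P hlam]
  have h1 := Finset.orderEmbOfFin_unique hcard (f := f)
    (fun k => by simpa [hne] using hr k) hf
  have h2 := Finset.orderEmbOfFin_unique hcard (f := fun k : Fin n => zero lam n k z)
    (fun k => by simpa [hne] using eval_P_zero hlam z k) (strictMono_zero hlam z n)
  exact congrFun (h1.trans h2.symm) k

theorem derivative_P_ne_zero (hlam : -1 / 2 < lam) (z : ℝ) {n : ℕ} {x : ℝ}
    (hx : (P lam z n).eval x = 0) : (derivative (P lam z n)).eval x ≠ 0 := by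
  cases n with
  | zero => simp [P_zero hlam] at hx
  | succ n =>
    have hw := wronskian_pos hlam z n x
    rw [hx, mul_zero, sub_zero] at hw
    exact left_ne_zero_of_mul hw.ne'

theorem exists_eq_X_sub_C_mul {p : ℝ[X]} {x : ℝ} (hx : p.eval x = 0) :
    ∃ q : ℝ[X], p = (X - C x) * q ∧ q.eval x = (derivative p).eval x := by
  obtain ⟨q, hq⟩ := dvd_iff_isRoot.2 hx
  refine ⟨q, hq, ?_⟩
  rw [hq, derivative_mul]
  simp

theorem eventually_eval_mul_eval_neg {p : ℝ[X]} {x : ℝ} (hx : p.eval x = 0)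
    (hd : (derivative p).eval x ≠ 0) :
    ∀ᶠ δ in 𝓝[>] (0 : ℝ), p.eval (x - δ) * p.eval (x + δ) < 0 := by
  obtain ⟨q, hq, hqx⟩ := exists_eq_X_sub_C_mul hx
  have hc : Continuous fun δ : ℝ => q.eval (x - δ) * q.eval (x + δ) :=
    (q.continuous.comp (continuous_const.sub continuous_id)).mul
      (q.continuous.comp (continuous_const.add continuous_id))
  have h0 : ∀ᶠ δ in 𝓝 (0 : ℝ), 0 < q.eval (x - δ) * q.eval (x + δ) := by
    refine hc.continuousAt.eventually (lt_mem_nhds ?_)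
    beta_reduce
    rw [sub_zero, add_zero, hqx]
    exact mul_self_pos.2 hd
  filter_upwards [h0.filter_mono nhdsWithin_le_nhds, self_mem_nhdsWithin] with δ h1 h2
  have h3 : p.eval (x - δ) * p.eval (x + δ) =
      -(δ ^ 2 * (q.eval (x - δ) * q.eval (x + δ))) := by
    rw [hq]
    simp only [eval_mul, eval_sub, eval_X, eval_C]
    ring
  rw [h3, neg_lt_zero]
  have : (0 : ℝ) < δ := h2
  positivity

theorem exists_root_of_mul_neg {p : ℝ[X]} {a b : ℝ} (hab : a ≤ b)
    (h : p.eval a * p.eval b < 0) : ∃ y ∈ Set.Ioo a b, p.eval y = 0 := by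
  rcases mul_neg_iff.1 h with ⟨ha, hb⟩ | ⟨ha, hb⟩
  · exact intermediate_value_Ioo' hab p.continuous.continuousOn ⟨hb, ha⟩
  · exact intermediate_value_Ioo hab p.continuous.continuousOn ⟨ha, hb⟩

theorem continuousAt_P_eval (hlam : -1 / 2 < lam) {z : ℝ} (hz : 0 < z) (n : ℕ) (x : ℝ) :
    ContinuousAt (fun t => (P lam t n).eval x) z := by
  cases n with
  | zero => simp only [P_zero hlam]; exact continuousAt_const
  | succ n => exact (hasDerivAt_P_eval hlam hz n x).continuousAt

/-- Sign changes across small disjoint intervals around the `n` simple zeros persist for nearby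
parameters. Each interval then contains a zero, and since there are only `n` zeros, the order
identifies them. -/
theorem continuousAt_zero (hlam : -1 / 2 < lam) {z : ℝ} (hz : 0 < z) {n : ℕ} (k : Fin n) :
    ContinuousAt (zero lam n k) z := by
  rw [Metric.continuousAt_iff']
  intro ε hε
  have hsign : ∀ᶠ δ in 𝓝[>] (0 : ℝ), ∀ i : Fin n,
      (P lam z n).eval (zero lam n i z - δ) * (P lam z n).eval (zero lam n i z + δ) < 0 :=
    eventually_all.2 fun i => eventually_eval_mul_eval_neg (eval_P_zero hlam z i)
      (derivative_P_ne_zero hlam z (eval_P_zero hlam z i))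
  have hgap : ∀ᶠ δ in 𝓝[>] (0 : ℝ), ∀ i j : Fin n, i < j →
      zero lam n i z + δ < zero lam n j z - δ := by
    refine eventually_all.2 fun i => eventually_all.2 fun j => ?_
    by_cases hij : i < j
    · have hlt : zero lam n i z < zero lam n j z := strictMono_zero hlam z n hij
      have : ∀ᶠ δ in 𝓝[>] (0 : ℝ), δ < (zero lam n j z - zero lam n i z) / 2 :=
        (gt_mem_nhds (by linarith)).filter_mono nhdsWithin_le_nhds
      filter_upwards [this] with δ h _
      linarith
    · exact Eventually.of_forall fun δ h => absurd h hij
  have hsmall : ∀ᶠ δ in 𝓝[>] (0 : ℝ), δ < ε := (gt_mem_nhds hε).filter_mono nhdsWithin_le_nhds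
  obtain ⟨δ, hs, hg, hδε, hδ0⟩ :=
    (hsign.and (hgap.and (hsmall.and self_mem_nhdsWithin))).exists
  have hδ : (0 : ℝ) < δ := hδ0
  have hnear : ∀ᶠ t in 𝓝 z, ∀ i : Fin n,
      (P lam t n).eval (zero lam n i z - δ) * (P lam t n).eval (zero lam n i z + δ) < 0 :=
    eventually_all.2 fun i => ((continuousAt_P_eval hlam hz n _).mul
      (continuousAt_P_eval hlam hz n _)).eventually (gt_mem_nhds (hs i))
  filter_upwards [hnear] with t ht
  choose f hf hroot using fun i => exists_root_of_mul_neg (by linarith) (ht i)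
  have hmono : StrictMono f := fun i j hij =>
    (hf i).2.trans ((hg i j hij).trans (hf j).1)
  rw [← eq_zero_of_strictMono hlam t hmono hroot k, Real.dist_eq, abs_lt]
  constructor <;> linarith [(hf k).1, (hf k).2]

/-- Implicit differentiation by hand: with `P_z = (X - x(z)) q`, the vanishing of `P_t(x(t))` gives
`(x(t) - x(z)) q(x(t)) = -(P_t - P_z)(x(t))`. Divide by `t - z` and use continuity of `x`. -/
theorem hasDerivAt_zero_aux (hlam : -1 / 2 < lam) {z : ℝ} (hz : 0 < z) {n : ℕ}
    (k : Fin (n + 1)) :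
    HasDerivAt (zero lam (n + 1) k)
      (-(γ lam z (n + 1) * (zero lam (n + 1) k z * (P lam z n).eval (zero lam (n + 1) k z))) /
        (derivative (P lam z (n + 1))).eval (zero lam (n + 1) k z)) z := by
  set x := zero lam (n + 1) k with hx
  have hx0 : (P lam z (n + 1)).eval (x z) = 0 := eval_P_zero hlam z k
  obtain ⟨q, hq, hqx⟩ := exists_eq_X_sub_C_mul hx0
  have hd := derivative_P_ne_zero hlam z hx0
  have hcont : ContinuousAt x z := continuousAt_zero hlam hz k
  have hqc : Tendsto (fun t => q.eval (x t)) (𝓝[≠] z) (𝓝 (q.eval (x z))) :=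
    (q.continuous.continuousAt.comp hcont).tendsto.mono_left nhdsWithin_le_nhds
  have hqne : ∀ᶠ t in 𝓝[≠] z, q.eval (x t) ≠ 0 :=
    hqc.eventually_ne (by rwa [hqx])
  set D : ℝ[X] := C (γ lam z (n + 1)) * (X * P lam z n - P lam z (n + 1)) with hD
  have hDdeg : D.natDegree < n + 2 := by
    refine natDegree_lt_of_degree_lt (n := n + 1) ?_ (by omega)
    rw [hD, ← smul_eq_C_mul]
    exact (degree_smul_le _ _).trans_lt (degree_X_mul_P_sub_lt hlam z n)
  have hDx : D.eval (x z) = γ lam z (n + 1) * (x z * (P lam z n).eval (x z)) := by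
    rw [hD]
    simp [hx0]
  rw [hasDerivAt_iff_tendsto_slope, ← hDx, ← hqx, eval_eq_sum_range' hDdeg]
  have hlim : Tendsto (fun t => -(∑ i ∈ Finset.range (n + 2),
      slope (fun s => (P lam s (n + 1)).coeff i) z t * x t ^ i) / q.eval (x t)) (𝓝[≠] z)
      (𝓝 (-(∑ i ∈ Finset.range (n + 2), D.coeff i * x z ^ i) / q.eval (x z))) := by
    refine (tendsto_finsetSum _ fun i _ => ?_).neg.div hqc (by rwa [hqx])
    exact (hasDerivAt_iff_tendsto_slope.1 (hasDerivAt_P_coeff hlam hz n i)).mul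
      ((hcont.tendsto.mono_left nhdsWithin_le_nhds).pow i)
  refine hlim.congr' ?_
  filter_upwards [hqne, self_mem_nhdsWithin] with t ht htz
  have hne : t - z ≠ 0 := sub_ne_zero.2 htz
  have hN : ∀ s, (P lam s (n + 1)).natDegree < n + 2 := fun s => by
    rw [((isSMOP_P hlam s).1 (n + 1)).2]; omega
  have h1 : (P lam t (n + 1)).eval (x t) = 0 := eval_P_zero hlam t k
  have h2 : (P lam z (n + 1)).eval (x t) = (x t - x z) * q.eval (x t) := by
    conv_lhs => rw [hq]
    simp
  have h3 : ∑ i ∈ Finset.range (n + 2),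
      slope (fun s => (P lam s (n + 1)).coeff i) z t * x t ^ i =
      (t - z)⁻¹ * ((P lam t (n + 1)).eval (x t) - (P lam z (n + 1)).eval (x t)) := by
    rw [eval_eq_sum_range' (hN t), eval_eq_sum_range' (hN z), ← Finset.sum_sub_distrib,
      Finset.mul_sum]
    refine Finset.sum_congr rfl fun i _ => ?_
    rw [slope_def_field]
    field_simp
  rw [h3, h1, h2, slope_def_field]
  field_simp
  ring

theorem hasDerivAt_zero (hlam : -1 / 2 < lam) {z : ℝ} (hz : 0 < z) {n : ℕ} (k : Fin n) :
    0 < betaSq lam z n - zero lam n k z ^ 2 ∧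
      HasDerivAt (zero lam n k)
        (-(zero lam n k z / (2 * z)) *
          ((1 - zero lam n k z ^ 2) / (betaSq lam z n - zero lam n k z ^ 2))) z := by
  cases n with
  | zero => exact k.elim0
  | succ n =>
    have hx := eval_P_zero hlam z k
    have hβ := betaSq_sub_sq_pos hlam hz hx (zero_mem_Ioo hlam z k)
    refine ⟨hβ, (hasDerivAt_zero_aux hlam hz k).congr_deriv ?_⟩
    have hd := derivative_P_ne_zero hlam z hx
    have h1 := derivative_P_eval_of_isRoot hlam hz hx
    rw [← neg_div, div_mul_div_comm, div_eq_div_iff hd (by positivity)]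
    linear_combination (zero lam (n + 1) k z) * h1

end Zeros

/-! ### Symmetry of the zeros and monotonicity of their squares. -/

section Squares

variable {lam : ℝ}

/-- By parity, negating and reversing the list of zeros gives an increasing list of zeros again,
hence the same list. -/
theorem zero_rev (hlam : -1 / 2 < lam) (z : ℝ) {n : ℕ} (k : Fin n) :
    zero lam n (Fin.rev k : Fin n) z = -zero lam n k z := by
  have hmono : StrictMono (fun k : Fin n => -zero lam n (Fin.rev k : Fin n) z) := fun i j hij =>
    neg_lt_neg (strictMono_zero hlam z n (Fin.rev_lt_rev.2 hij))
  have h := eq_zero_of_strictMono hlam z hmono (fun i => ?_) k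
  · linarith
  · have h1 := congrArg (eval (zero lam n (Fin.rev i : Fin n) z)) (P_comp_neg_X hlam z n)
    rw [eval_comp, eval_mul, eval_P_zero hlam, mul_zero] at h1
    simpa using h1

theorem zero_eq_zero_iff (hlam : -1 / 2 < lam) (z : ℝ) {n : ℕ} (k : Fin n) :
    zero lam n k z = 0 ↔ 2 * (k : ℕ) + 1 = n := by
  have hr := zero_rev hlam z k
  have hk := k.2
  constructor
  · intro h
    rw [h, neg_zero, ← h] at hr
    have := congrArg Fin.val ((strictMono_zero hlam z n).injective hr)
    rw [Fin.val_rev] at this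
    omega
  · intro h
    have : Fin.rev k = k := Fin.ext (by rw [Fin.val_rev]; omega)
    rw [this] at hr
    linarith

theorem hasDerivAt_zero_sq (hlam : -1 / 2 < lam) {z : ℝ} (hz : 0 < z) {n : ℕ} (k : Fin n) :
    HasDerivAt (fun t => zero lam n k t ^ 2)
      (-(zero lam n k z ^ 2 / z *
        ((1 - zero lam n k z ^ 2) / (betaSq lam z n - zero lam n k z ^ 2)))) z := by
  refine ((hasDerivAt_zero hlam hz k).2.pow 2).congr_deriv ?_
  push_cast
  ring

theorem one_sub_zero_sq_pos (hlam : -1 / 2 < lam) (z : ℝ) {n : ℕ} (k : Fin n) :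
    0 < 1 - zero lam n k z ^ 2 := by
  have h := zero_mem_Ioo hlam z k
  nlinarith [h.1, h.2]

theorem antitoneOn_zero_sq (hlam : -1 / 2 < lam) {n : ℕ} (k : Fin n) :
    AntitoneOn (fun z => zero lam n k z ^ 2) (Set.Ioi 0) := by
  refine antitoneOn_of_deriv_nonpos (convex_Ioi 0)
    (fun z hz => (hasDerivAt_zero_sq hlam hz k).continuousAt.continuousWithinAt)
    (fun z hz => ?_) fun z hz => ?_ <;> rw [interior_Ioi] at hz
  · exact (hasDerivAt_zero_sq hlam hz k).differentiableAt.differentiableWithinAt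
  · rw [(hasDerivAt_zero_sq hlam hz k).deriv, neg_nonpos]
    have hz' : 0 < z := hz
    have h1 := one_sub_zero_sq_pos hlam z k
    have h2 := (hasDerivAt_zero hlam hz k).1
    positivity

theorem deriv_zero_sq_neg (hlam : -1 / 2 < lam) {z : ℝ} (hz : 0 < z) {n : ℕ} {k : Fin n}
    (hk : 2 * (k : ℕ) + 1 ≠ n) :
    -(zero lam n k z ^ 2 / z *
      ((1 - zero lam n k z ^ 2) / (betaSq lam z n - zero lam n k z ^ 2))) < 0 := by
  have h0 : zero lam n k z ≠ 0 := fun h => hk ((zero_eq_zero_iff hlam z k).1 h)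
  have h1 := one_sub_zero_sq_pos hlam z k
  have h2 := (hasDerivAt_zero hlam hz k).1
  rw [neg_lt_zero]
  positivity

theorem strictAntiOn_zero_sq (hlam : -1 / 2 < lam) {n : ℕ} {k : Fin n}
    (hk : 2 * (k : ℕ) + 1 ≠ n) :
    StrictAntiOn (fun z => zero lam n k z ^ 2) (Set.Ioi 0) := by
  refine strictAntiOn_of_deriv_neg (convex_Ioi 0)
    (fun z hz => (hasDerivAt_zero_sq hlam hz k).continuousAt.continuousWithinAt) fun z hz => ?_
  rw [interior_Ioi] at hz
  rw [(hasDerivAt_zero_sq hlam hz k).deriv]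
  exact deriv_zero_sq_neg hlam hz hk

end Squares

end GaussRys

end

theorem mainTheorem9 (lam : ℝ) (hlam : -1 / 2 < lam) :
    -- the objects are what they are meant to be
    (∀ z : ℝ, 0 < z →
      GaussRys.IsSMOP (GaussRys.functional lam z) (GaussRys.P lam z) ∧
      X * GaussRys.P lam z 0 = GaussRys.P lam z 1 ∧
      ∀ n : ℕ, X * GaussRys.P lam z (n + 1) =
        GaussRys.P lam z (n + 2) + C (GaussRys.γ lam z (n + 1)) * GaussRys.P lam z n) ∧
    (∀ (n : ℕ) (z : ℝ), 0 < z →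
      StrictMono (fun k : Fin n => GaussRys.zero lam n k z) ∧
      (∀ k : Fin n, GaussRys.zero lam n k z ∈ Set.Ioo (-1 : ℝ) 1) ∧
      (∀ x : ℝ, (GaussRys.P lam z n).IsRoot x ↔ ∃ k : Fin n, x = GaussRys.zero lam n k z)) ∧
    -- the derivative of the polynomials with respect to `z`
    (∀ n : ℕ, 2 ≤ n → ∀ z : ℝ, 0 < z → ∀ x : ℝ,
      HasDerivAt (fun t : ℝ => (GaussRys.P lam t n).eval x)
        (GaussRys.γ lam z n * GaussRys.γ lam z (n - 1) * (GaussRys.P lam z (n - 2)).eval x) z) ∧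
    -- the differential equation of the zeros
    (∀ (n : ℕ) (k : Fin n) (z : ℝ), 0 < z →
      0 < GaussRys.betaSq lam z n - GaussRys.zero lam n k z ^ 2 ∧
      HasDerivAt (GaussRys.zero lam n k)
        (-(GaussRys.zero lam n k z / (2 * z)) *
          ((1 - GaussRys.zero lam n k z ^ 2) /
            (GaussRys.betaSq lam z n - GaussRys.zero lam n k z ^ 2))) z) ∧
    -- the squares of the zeros decrease, strictly so except for the zero at the origin
    (∀ (n : ℕ) (k : Fin n),
      AntitoneOn (fun z : ℝ => GaussRys.zero lam n k z ^ 2) (Set.Ioi 0) ∧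
      (2 * (k : ℕ) + 1 = n → ∀ z : ℝ, 0 < z → GaussRys.zero lam n k z = 0) ∧
      (2 * (k : ℕ) + 1 ≠ n →
        StrictAntiOn (fun z : ℝ => GaussRys.zero lam n k z ^ 2) (Set.Ioi 0) ∧
        ∀ z : ℝ, 0 < z → GaussRys.zero lam n k z ≠ 0 ∧
          ∃ y' : ℝ, HasDerivAt (fun t : ℝ => GaussRys.zero lam n k t ^ 2) y' z ∧ y' < 0 ∧
            y' * (GaussRys.betaSq lam z n / GaussRys.zero lam n k z ^ 2 +
              (GaussRys.betaSq lam z n - 1) / (1 - GaussRys.zero lam n k z ^ 2)) = -1 / z)) := by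
  refine ⟨fun z _ => ⟨GaussRys.isSMOP_P hlam z, ?_, GaussRys.X_mul_P_succ hlam z⟩,
    fun n z _ => ⟨GaussRys.strictMono_zero hlam z n, GaussRys.zero_mem_Ioo hlam z,
      GaussRys.isRoot_P_iff hlam z n⟩, fun n hn z hz x => ?_,
    fun n k z hz => GaussRys.hasDerivAt_zero hlam hz k,
    fun n k => ⟨GaussRys.antitoneOn_zero_sq hlam k,
      fun h z _ => (GaussRys.zero_eq_zero_iff hlam z k).2 h,
      fun h => ⟨GaussRys.strictAntiOn_zero_sq hlam h, fun z hz => ?_⟩⟩⟩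
  · rw [GaussRys.P_zero hlam, GaussRys.P_one hlam, mul_one]
  · obtain ⟨m, rfl⟩ : ∃ m, n = m + 2 := ⟨n - 2, by omega⟩
    refine (GaussRys.hasDerivAt_P_eval hlam hz (m + 1) x).congr_deriv ?_
    have h := congrArg (eval x) (GaussRys.X_mul_P_succ hlam z m)
    simp only [eval_mul, eval_add, eval_X, eval_C] at h
    show _ = GaussRys.γ lam z (m + 2) * GaussRys.γ lam z (m + 1) * (GaussRys.P lam z m).eval x
    linear_combination GaussRys.γ lam z (m + 2) * h
  · have h0 : GaussRys.zero lam n k z ≠ 0 :=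
      fun h' => h ((GaussRys.zero_eq_zero_iff hlam z k).1 h')
    refine ⟨h0, _, GaussRys.hasDerivAt_zero_sq hlam hz k, GaussRys.deriv_zero_sq_neg hlam hz h, ?_⟩
    have h1 := (GaussRys.one_sub_zero_sq_pos hlam z k).ne'
    have h2 := (GaussRys.hasDerivAt_zero hlam hz k).1.ne'
    -- With `y = x²`, the bracket equals `(β² - y) / (y (1 - y))`, the reciprocal of `-z y'`.
    field_simp
    ring
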